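/- Let $a,b>-1$ and let $\sigma$ be the Jacobi probability measure on $\mathbb{R}$, i.e. the measure supported on $[-1,1]$ with density proportional to $(1-x)^a(1+x)^b$. Let $\{r_n\}_{n\ge 0}$ be the orthonormal polynomials with respect to $\sigma$ ($\deg r_n=n$, positive leading coefficients). Let $A$ be the linear operator $A q(\lambda)=\lambda q(\lambda)+q(0)$ on polynomials (the case $c=0$, $d=1$ of $q\mapsto \lambda q(\lambda)+q(0)(c\lambda+d)$), and write $Ax^k=\sum_j \xi_{k,j}x^j$. Put $$S(u,v)=\int_{\mathbb{R}} u(A)(1)\,\overline{v(A)(1)}\,d\sigma \qquad (u,v\in\mathbb{C}[\lambda]).$$ Let $J_3$ be the Jacobi matrix of $\sigma$, with entries $(J_3)_{i,j}=\int x\,r_i r_j\,d\sigma$, let $J_5=J_3^2$, and let $$\alpha=\frac{1}{\xi_{0,1}\sqrt{\Delta_1}},\qquad \beta=-\frac{\xi_{0,1}s_1+\xi_{0,0}}{\xi_{0,1}\sqrt{\Delta_1}},$$ where $s_j=\int x^j\,d\sigma$ and $\Delta_1=s_0s_2-s_1^2$. Let $\{p_n\}_{n\ge0}$ be the associated polynomials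 of $\Theta=(J_3,J_5,\alpha,\beta)$, i.e. $p_0=1$, $p_1(\lambda)=\alpha\lambda+\beta$ and $(J_5-\lambda J_3)(p_0(\lambda),p_1(\lambda),p_2(\lambda),\dots)^T=0$. Then $\Theta$ is a Jacobi-type pencil ($\alpha>0$; $J_3$ is real symmetric and three-diagonal with positive first subdiagonal; $J_5$ is real symmetric and five-diagonal with positive second subdiagonal) with spectral function $S$ ($S$ is sesquilinear and $S(p_n,p_m)=\delta_{n,m}$ for all $n,m\ge0$). Moreover, for every integer $n\ge 0$: (1) $p_n(\lambda)=r_n(\lambda)-\dfrac{r_n(\lambda)-r_n(0)}{\lambda}$ (the quotient being understood as a polynomial). (2) For $\lambda_n=n(n+a+b+1)$, the polynomial $p_n$ has degree $n$ and satisfies the fourth-order differential equation $$-(t+1)t(t-1)^2y^{(4)}(t)+(t-1)\bigl(-(a+b+10)t^2+(b-a)t+4\bigr)y^{(3)}(t)$$ $$+\bigl(-3(2a+2b+8)t^2+(a+9b+22)t+3a-3b\bigr)y''(t)+\bigl(-6(a+b+2)t+2a+6b+8\bigr)y'(t)$$ $$+\lambda_n\bigl(t(t-1)y''(t)+2(2t-1)y'(t)+2y(t)\bigr)=0,$$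 and every real polynomial solution of degree $n$ of this equation is a constant multiple of $p_n$. (3) Among all real values substituted for $\lambda_n$ in this equation, $n(n+a+b+1)$ is the only one for which the equation has a real polynomial solution of degree $n$. -/

import Mathlib

open Polynomial MeasureTheory

noncomputable section

namespace JacobiPencil

/-- The weight `(1 - x)^a (1 + x)^b` on `(-1, 1)`, as a measure on the real line. -/
def jacobiWeight (a b : ℝ) : Measure ℝ :=
  (volume.restrict (Set.Ioo (-1 : ℝ) 1)).withDensity
    fun x => ENNReal.ofReal ((1 - x) ^ a * (1 + x) ^ b)

/-- The Jacobi measure: the Jacobi weight normalized to total mass one. -/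
def jacobiMeasure (a b : ℝ) : Measure ℝ :=
  (jacobiWeight a b Set.univ)⁻¹ • jacobiWeight a b

/-- `r` is the system of orthonormal polynomials (`deg r_n = n`, positive leading coefficients)
with respect to the measure `σ`. -/
structure IsOrthonormalSystem (σ : Measure ℝ) (r : ℕ → ℝ[X]) : Prop where
  natDegree_eq : ∀ n, (r n).natDegree = n
  leadingCoeff_pos : ∀ n, 0 < (r n).leadingCoeff
  orthonormal : ∀ m n, ∫ x, (r m).eval x * (r n).eval x ∂σ = if m = n then 1 else 0

/-- The data `(J₃, J₅, α, β)`: two semi-infinite real matrices and two real numbers. -/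
structure Pencil where
  J₃ : Matrix ℕ ℕ ℝ
  J₅ : Matrix ℕ ℕ ℝ
  α : ℝ
  β : ℝ

/-- Jacobi-type pencils: `α > 0`, `J₃` is a Jacobi matrix (real symmetric, three-diagonal, with
positive first subdiagonal) and `J₅` is real symmetric, five-diagonal, with positive second
subdiagonal. -/
structure Pencil.IsJacobiType (Θ : Pencil) : Prop where
  α_pos : 0 < Θ.α
  J₃_symm : Θ.J₃.IsSymm
  J₃_band : ∀ i j, i + 1 < j → Θ.J₃ i j = 0
  J₃_pos : ∀ n, 0 < Θ.J₃ (n + 1) n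
  J₅_symm : Θ.J₅.IsSymm
  J₅_band : ∀ i j, i + 2 < j → Θ.J₅ i j = 0
  J₅_pos : ∀ n, 0 < Θ.J₅ (n + 2) n

/-- The polynomials associated to a pencil: `p₀ = 1`, `p₁ = α λ + β` and
`(J₅ - λ J₃) (p₀, p₁, p₂, …)ᵀ = 0`. For a pencil of Jacobi type every row of `J₅ - λ J₃` has
finitely many nonzero entries, so the sums are finite. -/
structure Pencil.IsAssociated (Θ : Pencil) (p : ℕ → ℝ[X]) : Prop where
  zero : p 0 = 1
  one : p 1 = C Θ.α * X + C Θ.β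
  row : ∀ n, ∑ᶠ k, (C (Θ.J₅ n k) - X * C (Θ.J₃ n k)) * p k = 0

/-- A functional `S` on pairs of complex polynomials is the spectral function of the pencil with
associated polynomials `p`: it is sesquilinear (linear in the first and conjugate-linear in the
second argument) and `S (p_n, p_m) = δ_{n,m}`. -/
def IsSpectralFunction (S : ℂ[X] → ℂ[X] → ℂ) (p : ℕ → ℝ[X]) : Prop :=
  (∃ B : ℂ[X] →ₗ[ℂ] ℂ[X] →ₗ⋆[ℂ] ℂ, ∀ u v, S u v = B u v) ∧
    ∀ n m, S ((p n).map (algebraMap ℝ ℂ)) ((p m).map (algebraMap ℝ ℂ)) = if n = m then 1 else 0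

/-- The operator `q ↦ λ q(λ) + q(0) (c λ + d)` on polynomials. -/
def modelOp {R : Type*} [CommRing R] (c d : R) : R[X] →ₗ[R] R[X] where
  toFun q := X * q + C (q.eval 0) * (C c * X + C d)
  map_add' p q := by simp only [eval_add, C_add]; ring
  map_smul' k q := by
    simp only [smul_eq_C_mul, eval_mul, eval_C, C_mul, RingHom.id_apply]; ring

/-- `S(u, v) = ∫ u(A)(1) · conj (v(A)(1)) dσ`, where `A` is the operator
`q ↦ λ q(λ) + q(0) (c λ + d)` on complex polynomials. -/
def spectralForm (σ : Measure ℝ) (c d : ℝ) (u v : ℂ[X]) : ℂ :=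
  ∫ x : ℝ, (aeval (modelOp (c : ℂ) (d : ℂ)) u 1).eval (x : ℂ) *
    starRingEnd ℂ ((aeval (modelOp (c : ℂ) (d : ℂ)) v 1).eval (x : ℂ)) ∂σ

/-- The power moments `s_j` of `σ`. -/
def powerMoment (σ : Measure ℝ) (j : ℕ) : ℝ := ∫ x, x ^ j ∂σ

/-- The Hankel determinants `Δ_n = det (s_{k+l})_{k,l=0}^n`. -/
def hankelDet (σ : Measure ℝ) (n : ℕ) : ℝ :=
  (Matrix.of fun k l : Fin (n + 1) => powerMoment σ (k + l)).det

/-- The coefficients `ξ_{k,j}` of the model operator: `A x^k = ∑_j ξ_{k,j} x^j`. -/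
def modelCoeff (c d : ℝ) (k j : ℕ) : ℝ := (modelOp c d (X ^ k)).coeff j

/-- The Jacobi matrix of `σ`: the matrix of multiplication by the independent variable in the
orthonormal polynomials `r` of `σ`. -/
def jacobiMatrix (σ : Measure ℝ) (r : ℕ → ℝ[X]) : Matrix ℕ ℕ ℝ :=
  fun i j => ∫ x, x * ((r i).eval x * (r j).eval x) ∂σ

/-- The pencil constructed from the measure `σ` (with orthonormal polynomials `r`) and the operator
`q ↦ λ q(λ) + q(0) (c λ + d)`: `J₃` is the Jacobi matrix of `σ`, `J₅ = J₃²` (the sums are finite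
because `J₃` is three-diagonal),
`α = 1 / (ξ_{0,1} √Δ₁)` and `β = -(ξ_{0,1} s₁ + ξ_{0,0}) / (ξ_{0,1} √Δ₁)`. -/
def pencil (σ : Measure ℝ) (r : ℕ → ℝ[X]) (c d : ℝ) : Pencil where
  J₃ := jacobiMatrix σ r
  J₅ := fun i j => ∑ᶠ k, jacobiMatrix σ r i k * jacobiMatrix σ r k j
  α := 1 / (modelCoeff c d 0 1 * √(hankelDet σ 1))
  β := -(modelCoeff c d 0 1 * powerMoment σ 1 + modelCoeff c d 0 0) /
    (modelCoeff c d 0 1 * √(hankelDet σ 1))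

/-- The polynomial `y` solves the fourth-order differential equation with parameters `a`, `b` and
spectral parameter `lam`. -/
def IsSolution (a b lam : ℝ) (y : ℝ[X]) : Prop :=
  ∀ t : ℝ,
    -(t + 1) * t * (t - 1) ^ 2 * (derivative^[4] y).eval t
      + (t - 1) * (-(a + b + 10) * t ^ 2 + (b - a) * t + 4) * (derivative^[3] y).eval t
      + (-3 * (2 * a + 2 * b + 8) * t ^ 2 + (a + 9 * b + 22) * t + 3 * a - 3 * b)
          * (derivative^[2] y).eval t
      + (-6 * (a + b + 2) * t + 2 * a + 6 * b + 8) * (derivative y).eval t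
      + lam * (t * (t - 1) * (derivative^[2] y).eval t
          + 2 * (2 * t - 1) * (derivative y).eval t + 2 * y.eval t) = 0

end JacobiPencil

end

/-!
Let `D q = q - (q - q(0)) / X`. Since the powers of `A : q ↦ X q + q(0)` satisfy
`A ^ (n + 1) 1 - A ^ n 1 = X ^ (n + 1)`, the degree-preserving bijection `D` of `ℝ[X]` inverts
`u ↦ u(A)(1)` (`aeval_modelOp_divXTransform`), so `S (D f, D g) = ∫ f g dσ`, and the polynomials
`D (r n)` are orthonormal for `S`. As `D (X² q) = X D (X q)`, and the rows of `J₃` and `J₅ = J₃²` are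
the coordinates of `X r n` and `X² r n` in the basis `r`, the `D (r n)` satisfy the recurrence of the
pencil (`IsOrthonormalSystem.isAssociated_pencil`). The recurrence determines its solution
because `J₅ n (n + 2) > 0`, hence `p n = D (r n)`.

For the differential equation, let `L` be the Jacobi differential operator. The left side of the
equation at `y = D q` is the second derivative of `(X - 1)² (L q + lam q)`; hence `D q` is a solution
exactly when `L q + lam q = 0` (`isSolution_divXTransform_iff`). Everything thus reduces to
polynomial eigenfunctions of `L`: the `r n` are eigenfunctions because `L` is symmetric with
respect to `σ` (`jacobiIntegral_jacobiOp_mul`) and does not raise degrees, the leading coefficient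
determines the eigenvalue, and the eigenvalues `n (n + a + b + 1)` are pairwise distinct, so that
there is only one eigenfunction of each degree up to a constant factor.
-/

/-! ### The difference-quotient transform -/

namespace JacobiPencil

/-- The operator `q ↦ q - (q - q(0)) / X` on polynomials. It is the inverse of
`u ↦ u(A)(1)`, where `A` is the operator `q ↦ X q + q(0)`. -/
noncomputable def divXTransform (q : ℝ[X]) : ℝ[X] := q - q.divX

theorem X_mul_divXTransform (q : ℝ[X]) :
    X * divXTransform q = (X - 1) * q + C (q.eval 0) := by
  have h := divX_mul_X_add q
  rw [coeff_zero_eq_eval_zero] at h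
  unfold divXTransform
  linear_combination -h

theorem divXTransform_sub_C (q : ℝ[X]) :
    q - (q - C (q.eval 0)).divX = divXTransform q := by
  rw [sub_eq_add_neg q (C _), ← C_neg, divX_add, divX_C, add_zero, divXTransform]

theorem divXTransform_add (p q : ℝ[X]) :
    divXTransform (p + q) = divXTransform p + divXTransform q := by
  simp only [divXTransform, divX_add]; ring

theorem divXTransform_C_mul (k : ℝ) (q : ℝ[X]) :
    divXTransform (C k * q) = C k * divXTransform q := by
  simp only [divXTransform, divX_C_mul]; ring

theorem divXTransform_sum (s : Finset ℕ) (c : ℕ → ℝ) (q : ℕ → ℝ[X]) :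
    divXTransform (∑ k ∈ s, C (c k) * q k) = ∑ k ∈ s, C (c k) * divXTransform (q k) := by
  induction s using Finset.cons_induction with
  | empty => simp [divXTransform]
  | cons i s hi ih =>
    rw [Finset.sum_cons, Finset.sum_cons, divXTransform_add, divXTransform_C_mul, ih]

theorem divXTransform_X_mul (q : ℝ[X]) : divXTransform (X * q) = X * q - q := by
  have h : (X * q).divX = q := by ext n; rw [coeff_divX, coeff_X_mul]
  rw [divXTransform, h]

theorem degree_divXTransform (q : ℝ[X]) : (divXTransform q).degree = q.degree := by
  by_cases h : q = 0
  · simp [h, divXTransform]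
  · exact degree_sub_eq_left_of_degree_lt (degree_divX_lt h)

theorem divXTransform_surjective : Function.Surjective divXTransform := by
  intro y
  obtain ⟨q, hq⟩ : (X - C 1) ∣ X * y - C (y.eval 1) := dvd_iff_isRoot.2 (by simp)
  rw [C_1] at hq
  refine ⟨q, mul_left_cancel₀ X_ne_zero ?_⟩
  have h0 := congrArg (eval 0) hq
  simp only [eval_sub, eval_mul, eval_X, eval_C, eval_one] at h0
  rw [X_mul_divXTransform, show q.eval 0 = y.eval 1 by linarith]
  linear_combination -hq

theorem aeval_modelOp_divXTransform (q : ℝ[X]) :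
    aeval (modelOp ((0 : ℝ) : ℂ) ((1 : ℝ) : ℂ)) ((divXTransform q).map (algebraMap ℝ ℂ)) 1
      = q.map (algebraMap ℝ ℂ) := by
  set A := modelOp ((0 : ℝ) : ℂ) ((1 : ℝ) : ℂ) with hA
  have hApp (q : ℂ[X]) : A q = X * q + C (q.eval 0) := by simp [hA, modelOp]
  -- telescoping: `A ^ (n + 1) 1 - A ^ n 1 = X ^ (n + 1)`
  have hpow (n : ℕ) : (A ^ (n + 1)) 1 - (A ^ n) 1 = X ^ (n + 1) := by
    induction n with
    | zero => simp [hApp]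
    | succ n ih =>
      rw [pow_succ' A (n + 1), Module.End.mul_apply, pow_succ' A n, Module.End.mul_apply,
        ← map_sub, ← Module.End.mul_apply, ← pow_succ', ih, hApp]
      simp; ring
  induction q using Polynomial.induction_on' with
  | add p q hp hq => simp only [divXTransform_add, Polynomial.map_add, map_add,
      LinearMap.add_apply, hp, hq]
  | monomial n k =>
    rw [← C_mul_X_pow_eq_monomial, divXTransform_C_mul]
    cases n with
    | zero => simp [divXTransform, Algebra.smul_def]
    | succ n =>
      rw [pow_succ', divXTransform_X_mul, ← pow_succ']
      simp only [Polynomial.map_mul, Polynomial.map_sub, Polynomial.map_pow, map_X, map_C,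
        map_mul, map_sub, map_pow, aeval_X, aeval_C, Module.End.mul_apply, LinearMap.sub_apply,
        hpow, Module.algebraMap_end_apply, smul_eq_C_mul]

/-! ### The Jacobi differential operator -/

/-- The Jacobi differential operator `q ↦ (1 - x²) q'' + (b - a - (a + b + 2) x) q'`. -/
noncomputable def jacobiOp (a b : ℝ) : ℝ[X] →ₗ[ℝ] ℝ[X] where
  toFun q := (1 - X ^ 2) * derivative (derivative q)
    + (C (b - a) - C (a + b + 2) * X) * derivative q
  map_add' p q := by simp only [derivative_add]; ring
  map_smul' k q := by simp only [smul_eq_C_mul, derivative_C_mul, RingHom.id_apply]; ring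

theorem jacobiOp_apply (a b : ℝ) (q : ℝ[X]) :
    jacobiOp a b q = (1 - X ^ 2) * derivative (derivative q)
      + (C (b - a) - C (a + b + 2) * X) * derivative q := rfl

theorem coeff_jacobiOp (a b : ℝ) (q : ℝ[X]) (n : ℕ) :
    (jacobiOp a b q).coeff n = (n + 2) * (n + 1) * q.coeff (n + 2)
      + (b - a) * (n + 1) * q.coeff (n + 1) - n * (n + a + b + 1) * q.coeff n := by
  rw [jacobiOp_apply, sub_mul, sub_mul, one_mul, mul_assoc (C _) X, coeff_add, coeff_sub, coeff_sub,
    coeff_C_mul, coeff_C_mul]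
  rcases n with _ | _ | n <;>
  simp [coeff_X_pow_mul', coeff_derivative, coeff_X_mul] <;> ring

theorem natDegree_jacobiOp_le (a b : ℝ) (q : ℝ[X]) :
    (jacobiOp a b q).natDegree ≤ q.natDegree := by
  rw [natDegree_le_iff_coeff_eq_zero]
  intro n hn
  rw [coeff_jacobiOp, coeff_eq_zero_of_natDegree_lt (show q.natDegree < n + 2 by omega),
    coeff_eq_zero_of_natDegree_lt (show q.natDegree < n + 1 by omega),
    coeff_eq_zero_of_natDegree_lt (show q.natDegree < n by omega)]
  simp

/-- The eigenvalue of a polynomial eigenfunction is determined by its degree: compare leading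
coefficients. -/
theorem eigenvalue_eq_of_jacobiOp {a b lam : ℝ} {q : ℝ[X]} (hq : q ≠ 0)
    (h : jacobiOp a b q + C lam * q = 0) :
    lam = q.natDegree * (q.natDegree + a + b + 1) := by
  have h1 := congrArg (fun f => coeff f q.natDegree) h
  simp only [coeff_add, coeff_C_mul, coeff_zero] at h1
  rw [coeff_jacobiOp, coeff_eq_zero_of_natDegree_lt (show q.natDegree < q.natDegree + 2 by omega),
    coeff_eq_zero_of_natDegree_lt (show q.natDegree < q.natDegree + 1 by omega)] at h1
  have h2 : q.coeff q.natDegree ≠ 0 := by simpa using hq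
  apply mul_right_cancel₀ h2
  linarith

/-- The eigenvalues `n (n + a + b + 1)` are pairwise distinct as `a + b + 2 > 0`, so an
eigenfunction is determined by its degree up to a constant factor. -/
theorem eq_C_mul_of_jacobiOp {a b : ℝ} (ha : -1 < a) (hb : -1 < b) {n : ℕ} {q r : ℝ[X]}
    (hq : q.degree = n) (hr : r.degree = n)
    (hq' : jacobiOp a b q + C (n * (n + a + b + 1)) * q = 0)
    (hr' : jacobiOp a b r + C (n * (n + a + b + 1)) * r = 0) : ∃ k : ℝ, q = C k * r := by
  have hr0 : r ≠ 0 := by rintro rfl; simp at hr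
  have hl : r.leadingCoeff ≠ 0 := leadingCoeff_ne_zero.2 hr0
  set k := q.leadingCoeff / r.leadingCoeff with hk
  have hk0 : k ≠ 0 := div_ne_zero (leadingCoeff_ne_zero.2 (by rintro rfl; simp at hq)) hl
  refine ⟨k, ?_⟩
  by_contra hne
  have hd0 : q - C k * r ≠ 0 := sub_ne_zero.2 hne
  have hlt : (q - C k * r).degree < n := by
    rw [← hq]
    apply degree_sub_lt_left
    · rw [degree_C_mul hk0, hq, hr]
    · rintro rfl; simp at hq
    · rw [leadingCoeff_mul, leadingCoeff_C, hk, div_mul_cancel₀ _ hl]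
  have hm : (q - C k * r).natDegree < n := by
    rwa [degree_eq_natDegree hd0, Nat.cast_lt] at hlt
  have hd : jacobiOp a b (q - C k * r) + C (n * (n + a + b + 1)) * (q - C k * r) = 0 := by
    rw [map_sub, ← smul_eq_C_mul k, map_smul]
    simp only [smul_eq_C_mul]
    linear_combination hq' - C k * hr'
  have he := eigenvalue_eq_of_jacobiOp hd0 hd
  generalize (q - C k * r).natDegree = m at hm he
  have hmn : (m : ℝ) + 1 ≤ n := by exact_mod_cast hm
  have hm0 : (0 : ℝ) ≤ m := m.cast_nonneg
  have : ((n : ℝ) - m) * (n + m + a + b + 1) = 0 := by linarith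
  rcases mul_eq_zero.1 this with h | h <;> linarith

/-! ### The fourth-order equation -/

theorem eq_zero_of_derivative_sq_mul {f : ℝ[X]}
    (h : derivative (derivative ((X - 1) ^ 2 * f)) = 0) : f = 0 := by
  have h1 : derivative ((X - 1) ^ 2 * f) = 0 := by
    obtain ⟨c, hc⟩ := natDegree_eq_zero.1 (derivative_eq_zero.1 h)
    have := congrArg (eval 1) hc
    simp [pow_two] at this
    simp [← hc, this]
  obtain ⟨c, hc⟩ := natDegree_eq_zero.1 (derivative_eq_zero.1 h1)
  have h2 := congrArg (eval 1) hc
  simp at h2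
  rw [h2, C_0] at hc
  have h3 : (X - 1 : ℝ[X]) ≠ 0 := by simpa using X_sub_C_ne_zero (1 : ℝ)
  exact (mul_eq_zero.1 hc.symm).resolve_left (pow_ne_zero 2 h3)

/-- The left side of the fourth-order equation at `y = divXTransform q` is the second derivative
of `(X - 1)² (L q + lam q)`, where `L` is the Jacobi operator: substituting
`q = (X y - q(0)) / (X - 1)` into the latter polynomial, the constant `q(0)` enters only through a
polynomial of degree at most one. A polynomial divisible by `(X - 1)²` with vanishing second
derivative is zero. -/
theorem isSolution_divXTransform_iff (a b lam : ℝ) (q : ℝ[X]) :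
    IsSolution a b lam (divXTransform q) ↔ jacobiOp a b q + C lam * q = 0 := by
  have h0 := X_mul_divXTransform q
  generalize divXTransform q = y at *
  generalize q.eval 0 = c at h0
  have h1 := congrArg derivative h0
  have h2 := congrArg derivative h1
  simp only [derivative_mul, derivative_X, derivative_add, derivative_sub, derivative_one,
    derivative_C, derivative_zero] at h1 h2
  have key : (X - 1) ^ 2 * (jacobiOp a b q + C lam * q)
      = -(X + 1) * (X - 1) ^ 2 * (X * derivative (derivative y) + 2 * derivative y)
        + 2 * (X ^ 2 - 1) * (X * derivative y + y) - 2 * (X + 1) * (X * y)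
        + (C (b - a) - C (a + b + 2) * X) * ((X - 1) * (X * derivative y + y) - X * y)
        + C lam * (X - 1) * (X * y)
        + C c * (2 * (X + 1) + (C (b - a) - C (a + b + 2) * X) - C lam * (X - 1)) := by
    rw [jacobiOp_apply]
    linear_combination (X + 1) * (X - 1) ^ 2 * h2
      - (2 * (X ^ 2 - 1) + (C (b - a) - C (a + b + 2) * X) * (X - 1)) * h1
      + (2 * (X + 1) + (C (b - a) - C (a + b + 2) * X) - C lam * (X - 1)) * h0
  have hiff : IsSolution a b lam y ↔
      derivative (derivative ((X - 1) ^ 2 * (jacobiOp a b q + C lam * q))) = 0 := by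
    rw [key, IsSolution]
    refine Iff.trans (forall_congr' fun t => ?_) (⟨Polynomial.funext, fun h t => by rw [h]⟩ :
      (∀ t, eval t _ = eval t 0) ↔ _)
    rw [eval_zero]
    refine Eq.congr_left ?_
    simp only [derivative_mul, derivative_X, derivative_add, derivative_sub, derivative_one,
      derivative_C, derivative_zero, derivative_neg, derivative_pow, derivative_ofNat,
      Function.iterate_succ, Function.iterate_zero, Function.comp_apply, id, eval_add, eval_mul,
      eval_sub, eval_neg, eval_X, eval_C, eval_one, eval_pow, eval_zero, eval_ofNat]
    ring
  rw [hiff]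
  exact ⟨eq_zero_of_derivative_sq_mul, fun h => by simp [h]⟩

/-! ### Orthonormal expansions -/

theorem exists_eq_sum_of_degree_lt {r : ℕ → ℝ[X]} (hd : ∀ n, (r n).natDegree = n)
    (hl : ∀ n, 0 < (r n).leadingCoeff) (N : ℕ) :
    ∀ q : ℝ[X], q.degree < N → ∃ c : ℕ → ℝ, q = ∑ k ∈ Finset.range N, C (c k) * r k := by
  induction N with
  | zero => intro q hq; exact ⟨0, by simpa using hq⟩
  | succ N ih =>
    intro q hq
    set l := q.coeff N / (r N).leadingCoeff
    have hlt : (q - C l * r N).degree < N := by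
      rw [degree_lt_iff_coeff_zero]
      intro m hm
      rw [coeff_sub, coeff_C_mul]
      rcases hm.eq_or_lt with rfl | hm
      · have : (r N).coeff N = (r N).leadingCoeff := by rw [leadingCoeff, hd]
        rw [this, div_mul_cancel₀ _ (hl N).ne', sub_self]
      · rw [(degree_lt_iff_coeff_zero q (N + 1)).1 hq m hm,
          coeff_eq_zero_of_natDegree_lt (by rw [hd]; exact hm), mul_zero, sub_zero]
    obtain ⟨c, hc⟩ := ih _ hlt
    refine ⟨fun k => if k = N then l else c k, ?_⟩
    rw [Finset.sum_range_succ, ← sub_eq_iff_eq_add]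
    simp only [if_true]
    rw [hc]
    refine Finset.sum_congr rfl fun k hk => ?_
    rw [if_neg (Finset.mem_range.1 hk).ne]

section Expansion

variable {r : ℕ → ℝ[X]} {I : ℝ[X] →ₗ[ℝ] ℝ}

theorem eq_sum_of_degree_lt (hd : ∀ n, (r n).natDegree = n) (hl : ∀ n, 0 < (r n).leadingCoeff)
    (ho : ∀ m n, I (r m * r n) = if m = n then 1 else 0) {N : ℕ} {q : ℝ[X]}
    (hq : q.degree < N) : q = ∑ k ∈ Finset.range N, C (I (q * r k)) * r k := by
  obtain ⟨c, hc⟩ := exists_eq_sum_of_degree_lt hd hl N q hq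
  conv_lhs => rw [hc]
  refine Finset.sum_congr rfl fun k hk => ?_
  congr 2
  rw [hc, Finset.sum_mul, map_sum, Finset.sum_congr rfl
    (g := fun i => if i = k then c i else 0), Finset.sum_ite_eq' , if_pos hk]
  intro i _
  rw [← smul_eq_C_mul, smul_mul_assoc, map_smul, ho]
  simp

theorem apply_mul_of_natDegree_le (hd : ∀ n, (r n).natDegree = n)
    (hl : ∀ n, 0 < (r n).leadingCoeff)
    (ho : ∀ m n, I (r m * r n) = if m = n then 1 else 0) {n : ℕ} {q : ℝ[X]}
    (hq : q.natDegree ≤ n) : I (q * r n) = q.coeff n / (r n).leadingCoeff := by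
  have h := congrArg (fun f => coeff f n) (eq_sum_of_degree_lt hd hl ho
    (degree_le_natDegree.trans_lt (Nat.cast_lt.2 (Nat.lt_succ_of_le hq))))
  simp only [finsetSum_coeff, coeff_C_mul] at h
  rw [Finset.sum_range_succ, Finset.sum_eq_zero, zero_add] at h
  · rw [eq_div_iff (hl n).ne', h, leadingCoeff, hd]
  · intro k hk
    rw [coeff_eq_zero_of_natDegree_lt (by rw [hd]; exact Finset.mem_range.1 hk), mul_zero]

theorem apply_mul_eq_zero (hd : ∀ n, (r n).natDegree = n)
    (hl : ∀ n, 0 < (r n).leadingCoeff)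
    (ho : ∀ m n, I (r m * r n) = if m = n then 1 else 0) {n : ℕ} {q : ℝ[X]}
    (hq : q.natDegree < n) : I (q * r n) = 0 := by
  rw [apply_mul_of_natDegree_le hd hl ho hq.le, coeff_eq_zero_of_natDegree_lt hq, zero_div]

end Expansion

end JacobiPencil

/-! ### The Jacobi measure -/

namespace JacobiPencil

theorem jacobiDensity_pos (a b : ℝ) {x : ℝ} (hx : x ∈ Set.Ioo (-1 : ℝ) 1) :
    0 < (1 - x) ^ a * (1 + x) ^ b :=
  mul_pos (Real.rpow_pos_of_pos (by linarith [hx.2]) _)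
    (Real.rpow_pos_of_pos (by linarith [hx.1]) _)

theorem intervalIntegrable_jacobiDensity {a b : ℝ} (ha : -1 < a) (hb : -1 < b) :
    IntervalIntegrable (fun x : ℝ => (1 - x) ^ a * (1 + x) ^ b) volume (-1) 1 := by
  refine IntervalIntegrable.trans (b := 0) ?_ ?_
  · have h : IntervalIntegrable (fun x : ℝ => (1 + x) ^ b) volume (-1) 0 := by
      have := (intervalIntegral.intervalIntegrable_rpow' (a := 0) (b := 1) hb).comp_add_left 1
      simpa using this
    refine h.continuousOn_mul ?_
    rw [Set.uIcc_of_le (by norm_num)]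
    exact ContinuousOn.rpow_const (by fun_prop) fun x hx => Or.inl (by linarith [hx.2])
  · have h : IntervalIntegrable (fun x : ℝ => (1 - x) ^ a) volume 0 1 := by
      have := (intervalIntegral.intervalIntegrable_rpow' (a := 1) (b := 0) ha).comp_sub_left 1
      simpa using this
    refine h.mul_continuousOn ?_
    rw [Set.uIcc_of_le (by norm_num)]
    exact ContinuousOn.rpow_const (by fun_prop) fun x hx => Or.inl (by linarith [hx.1])

theorem measurable_jacobiDensity (a b : ℝ) :
    Measurable fun x : ℝ => ENNReal.ofReal ((1 - x) ^ a * (1 + x) ^ b) := by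
  fun_prop

theorem jacobiWeight_univ_ne_top {a b : ℝ} (ha : -1 < a) (hb : -1 < b) :
    jacobiWeight a b Set.univ ≠ ⊤ := by
  have h := (intervalIntegrable_iff_integrableOn_Ioo_of_le (by norm_num)).1
    (intervalIntegrable_jacobiDensity ha hb)
  rw [jacobiWeight, withDensity_apply _ MeasurableSet.univ, Measure.restrict_univ]
  exact h.lintegral_lt_top.ne

theorem jacobiWeight_univ_ne_zero (a b : ℝ) : jacobiWeight a b Set.univ ≠ 0 := by
  rw [jacobiWeight, withDensity_apply _ MeasurableSet.univ, Measure.restrict_univ]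
  refine (setLIntegral_pos_iff (measurable_jacobiDensity a b)).2 ?_ |>.ne'
  rw [Set.inter_eq_right.2]
  · simp
  · intro x hx
    simpa using jacobiDensity_pos a b hx

theorem isProbabilityMeasure_jacobiMeasure {a b : ℝ} (ha : -1 < a) (hb : -1 < b) :
    IsProbabilityMeasure (jacobiMeasure a b) := by
  refine ⟨?_⟩
  rw [jacobiMeasure, Measure.smul_apply, smul_eq_mul]
  exact ENNReal.inv_mul_cancel (jacobiWeight_univ_ne_zero a b) (jacobiWeight_univ_ne_top ha hb)

theorem integrable_jacobiMeasure {a b : ℝ} (ha : -1 < a) (hb : -1 < b) {E : Type*}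
    [NormedAddCommGroup E] {f : ℝ → E} (hf : Continuous f) : Integrable f (jacobiMeasure a b) := by
  have := isProbabilityMeasure_jacobiMeasure ha hb
  obtain ⟨M, hM⟩ := isCompact_Icc.exists_bound_of_continuousOn (s := Set.Icc (-1 : ℝ) 1)
    hf.continuousOn
  refine Integrable.of_bound hf.aestronglyMeasurable M ?_
  have h1 : ∀ᵐ x ∂(volume.restrict (Set.Ioo (-1 : ℝ) 1)), ‖f x‖ ≤ M :=
    (ae_restrict_mem measurableSet_Ioo).mono fun x hx => hM x (Set.Ioo_subset_Icc_self hx)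
  exact Measure.ae_smul_measure ((withDensity_absolutelyContinuous _ _).ae_le h1) _

theorem integral_jacobiMeasure (a b : ℝ) (f : ℝ → ℝ) :
    ∫ x, f x ∂(jacobiMeasure a b) = (jacobiWeight a b Set.univ)⁻¹.toReal *
      ∫ x in (-1 : ℝ)..1, (1 - x) ^ a * (1 + x) ^ b * f x := by
  rw [jacobiMeasure, integral_smul_measure, smul_eq_mul, jacobiWeight,
    integral_withDensity_eq_integral_toReal_smul (measurable_jacobiDensity a b)
      (Filter.Eventually.of_forall fun _ => ENNReal.ofReal_lt_top),
    intervalIntegral.integral_of_le (by norm_num), integral_Ioc_eq_integral_Ioo]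
  congr 1
  refine setIntegral_congr_fun measurableSet_Ioo fun x hx => ?_
  simp only [smul_eq_mul]
  rw [ENNReal.toReal_ofReal (jacobiDensity_pos a b hx).le]

/-- Integration of polynomials against the Jacobi measure, as a linear functional. -/
noncomputable def jacobiIntegral {a b : ℝ} (ha : -1 < a) (hb : -1 < b) : ℝ[X] →ₗ[ℝ] ℝ where
  toFun q := ∫ x, q.eval x ∂(jacobiMeasure a b)
  map_add' p q := by
    simp only [eval_add]
    exact integral_add (integrable_jacobiMeasure ha hb p.continuous)
      (integrable_jacobiMeasure ha hb q.continuous)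
  map_smul' k q := by
    simp only [eval_smul, smul_eq_mul, RingHom.id_apply]
    exact integral_const_mul _ _

theorem jacobiIntegral_apply {a b : ℝ} (ha : -1 < a) (hb : -1 < b) (q : ℝ[X]) :
    jacobiIntegral ha hb q = ∫ x, q.eval x ∂(jacobiMeasure a b) := rfl

/-- The Jacobi operator is symmetric: with the weight `w`, the function `w (L f g - f L g)` is the
derivative of `(1 - x²) w (f' g - f g')`, which vanishes at `±1`. -/
theorem jacobiIntegral_jacobiOp_mul {a b : ℝ} (ha : -1 < a) (hb : -1 < b) (f g : ℝ[X]) :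
    jacobiIntegral ha hb (jacobiOp a b f * g) = jacobiIntegral ha hb (f * jacobiOp a b g) := by
  rw [← sub_eq_zero, ← map_sub, jacobiIntegral_apply, integral_jacobiMeasure]
  set W := derivative f * g - f * derivative g with hW
  have hint : IntervalIntegrable (fun x : ℝ => (1 - x) ^ a * (1 + x) ^ b *
      (jacobiOp a b f * g - f * jacobiOp a b g).eval x) volume (-1) 1 :=
    (intervalIntegrable_jacobiDensity ha hb).mul_continuousOn (Polynomial.continuous _).continuousOn
  have hcont : ContinuousOn (fun x : ℝ => (1 - x) ^ (a + 1) * (1 + x) ^ (b + 1) * W.eval x)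
      (Set.Icc (-1) 1) := by
    refine Continuous.continuousOn (((Continuous.rpow_const (by fun_prop) ?_).mul
      (Continuous.rpow_const (by fun_prop) ?_)).mul W.continuous)
    · exact fun x => Or.inr (by linarith)
    · exact fun x => Or.inr (by linarith)
  rw [intervalIntegral.integral_eq_sub_of_hasDerivAt_of_le (by norm_num) hcont ?_ hint]
  · simp [Real.zero_rpow (show a + 1 ≠ 0 by linarith), Real.zero_rpow (show b + 1 ≠ 0 by linarith)]
  · intro x hx
    have h1 : 0 < 1 - x := by linarith [hx.2]
    have h2 : 0 < 1 + x := by linarith [hx.1]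
    have d1 := ((hasDerivAt_id x).const_sub 1).rpow_const (p := a + 1) (Or.inl h1.ne')
    have d2 := ((hasDerivAt_id x).const_add 1).rpow_const (p := b + 1) (Or.inl h2.ne')
    refine ((d1.mul d2).mul (W.hasDerivAt x)).congr_deriv ?_
    simp only [id, add_sub_cancel_right, Pi.mul_apply]
    rw [Real.rpow_add_one h1.ne', Real.rpow_add_one h2.ne', hW]
    simp only [jacobiOp_apply, derivative_sub, derivative_mul, eval_add, eval_sub, eval_mul,
      eval_X, eval_C, eval_pow, eval_one]
    ring

end JacobiPencil

/-! ### The pencil -/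

namespace JacobiPencil

/-- The associated polynomials are determined by the pencil: row `n` of the recurrence involves
`p (n + 2)` with the nonzero constant coefficient `J₅ n (n + 2)`. -/
theorem Pencil.IsAssociated.unique {Θ : Pencil} (hΘ : Θ.IsJacobiType) {p q : ℕ → ℝ[X]}
    (hp : Θ.IsAssociated p) (hq : Θ.IsAssociated q) (n : ℕ) : p n = q n := by
  have row {p : ℕ → ℝ[X]} (hp : Θ.IsAssociated p) (n : ℕ) :
      ∑ k ∈ Finset.range (n + 2), (C (Θ.J₅ n k) - X * C (Θ.J₃ n k)) * p k
        + C (Θ.J₅ n (n + 2)) * p (n + 2) = 0 := by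
    have h := hp.row n
    rw [finsum_eq_sum_of_support_subset (s := Finset.range (n + 3)), Finset.sum_range_succ,
      hΘ.J₃_band n (n + 2) (by omega), C_0, mul_zero, sub_zero] at h
    · exact h
    · intro k hk
      rw [Finset.coe_range, Set.mem_Iio]
      by_contra hlt
      exact hk (by simp [hΘ.J₃_band n k (by omega), hΘ.J₅_band n k (by omega)])
  induction n using Nat.strong_induction_on with
  | _ n ih =>
    match n, ih with
    | 0, _ => rw [hp.zero, hq.zero]
    | 1, _ => rw [hp.one, hq.one]
    | n + 2, ih =>
      have h1 := row hp n
      rw [Finset.sum_congr rfl fun k hk => by rw [ih k (Finset.mem_range.1 hk)]] at h1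
      have h2 : C (Θ.J₅ n (n + 2)) ≠ 0 := by
        rw [Ne, C_eq_zero, ← hΘ.J₅_symm.apply]
        exact (hΘ.J₅_pos n).ne'
      exact mul_left_cancel₀ h2 (add_left_cancel (h1.trans (row hq n).symm))

theorem hankelDet_one (σ : Measure ℝ) : hankelDet σ 1 =
    powerMoment σ 0 * powerMoment σ 2 - powerMoment σ 1 * powerMoment σ 1 := by
  simp [hankelDet, Matrix.det_fin_two]

theorem modelCoeff_zero_zero : modelCoeff 0 1 0 0 = 1 := by
  simp [modelCoeff, modelOp]

theorem modelCoeff_zero_one : modelCoeff 0 1 0 1 = 1 := by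
  simp [modelCoeff, modelOp, coeff_one]

section

variable {a b : ℝ} (ha : -1 < a) (hb : -1 < b) {r : ℕ → ℝ[X]}

include ha hb

theorem IsOrthonormalSystem.jacobiIntegral_mul
    (hr : IsOrthonormalSystem (jacobiMeasure a b) r) (m n : ℕ) :
    jacobiIntegral ha hb (r m * r n) = if m = n then 1 else 0 := by
  rw [jacobiIntegral_apply, ← hr.orthonormal m n]
  simp only [eval_mul]

theorem jacobiIntegral_X_pow (j : ℕ) :
    jacobiIntegral ha hb (X ^ j) = powerMoment (jacobiMeasure a b) j := by
  simp [jacobiIntegral_apply, powerMoment]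

theorem powerMoment_zero : powerMoment (jacobiMeasure a b) 0 = 1 := by
  have := isProbabilityMeasure_jacobiMeasure ha hb
  simp [powerMoment]

theorem IsOrthonormalSystem.zero_eq (hr : IsOrthonormalSystem (jacobiMeasure a b) r) :
    r 0 = 1 := by
  obtain ⟨c, hc⟩ := natDegree_eq_zero.1 (hr.natDegree_eq 0)
  have h1 := hr.leadingCoeff_pos 0
  have h2 := hr.jacobiIntegral_mul ha hb 0 0
  rw [← hc, leadingCoeff_C] at h1
  have h3 : C c * C c = (c * c) • (X ^ 0 : ℝ[X]) := by
    rw [smul_eq_C_mul, C_mul, pow_zero, mul_one]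
  rw [← hc, h3, map_smul, jacobiIntegral_X_pow, powerMoment_zero ha hb, if_pos rfl, smul_eq_mul,
    mul_one] at h2
  rw [← hc, show c = 1 by nlinarith, C_1]

theorem IsOrthonormalSystem.one_eq (hr : IsOrthonormalSystem (jacobiMeasure a b) r) :
    0 < hankelDet (jacobiMeasure a b) 1 ∧
    r 1 = C (1 / √(hankelDet (jacobiMeasure a b) 1))
      * (X - C (powerMoment (jacobiMeasure a b) 1)) := by
  rw [hankelDet_one, powerMoment_zero ha hb, one_mul]
  obtain ⟨l, m, hlm⟩ := exists_eq_X_add_C_of_natDegree_le_one (hr.natDegree_eq 1).le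
  have h0 := hr.leadingCoeff_pos 1
  have hl : (r 1).leadingCoeff = l := by rw [leadingCoeff, hr.natDegree_eq, hlm]; simp
  rw [hl] at h0
  have h1 := hr.jacobiIntegral_mul ha hb 1 0
  have h2 := hr.jacobiIntegral_mul ha hb 1 1
  rw [hr.zero_eq ha hb, hlm, show (C l * X + C m) * 1 = l • X ^ 1 + m • X ^ 0 by
    simp only [smul_eq_C_mul]; ring, map_add, map_smul, map_smul] at h1
  rw [hlm, show (C l * X + C m) * (C l * X + C m)
    = (l * l) • X ^ 2 + (2 * l * m) • X ^ 1 + (m * m) • X ^ 0 by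
      simp only [smul_eq_C_mul, C_mul, C_ofNat]; ring, map_add, map_add, map_smul, map_smul,
      map_smul] at h2
  simp only [jacobiIntegral_X_pow, powerMoment_zero ha hb, smul_eq_mul, mul_one, if_true] at h1 h2
  rw [if_neg one_ne_zero] at h1
  generalize powerMoment (jacobiMeasure a b) 1 = s₁ at *
  generalize powerMoment (jacobiMeasure a b) 2 = s₂ at *
  obtain rfl : m = -(l * s₁) := by linarith
  have h3 : l ^ 2 * (s₂ - s₁ * s₁) = 1 := by linear_combination h2
  have hpos : 0 < s₂ - s₁ * s₁ := pos_of_mul_pos_right (by rw [h3]; exact one_pos) (sq_nonneg l)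
  refine ⟨hpos, ?_⟩
  have h4 : s₂ - s₁ * s₁ = (1 / l) ^ 2 := by field_simp; linear_combination h3
  rw [h4, Real.sqrt_sq (by positivity), one_div_one_div, hlm]
  simp only [C_neg, C_mul]; ring

theorem jacobiMatrix_apply (i j : ℕ) : jacobiMatrix (jacobiMeasure a b) r i j
    = jacobiIntegral ha hb (X ^ 1 * r i * r j) := by
  rw [jacobiMatrix, jacobiIntegral_apply]
  simp only [eval_mul, eval_X, pow_one, mul_assoc]

theorem pencil_J₃_apply (c d : ℝ) (i j : ℕ) : (pencil (jacobiMeasure a b) r c d).J₃ i j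
    = jacobiIntegral ha hb (X ^ 1 * r i * r j) :=
  jacobiMatrix_apply ha hb i j

theorem IsOrthonormalSystem.jacobiIntegral_X_pow_mul_eq_zero
    (hr : IsOrthonormalSystem (jacobiMeasure a b) r) {m i j : ℕ} (h : i + m < j) :
    jacobiIntegral ha hb (X ^ m * r i * r j) = 0 := by
  refine apply_mul_eq_zero hr.natDegree_eq hr.leadingCoeff_pos (hr.jacobiIntegral_mul ha hb)
    (natDegree_mul_le.trans_lt ?_)
  rw [natDegree_X_pow, hr.natDegree_eq]; omega

theorem IsOrthonormalSystem.jacobiIntegral_X_pow_mul_pos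
    (hr : IsOrthonormalSystem (jacobiMeasure a b) r) (m i : ℕ) :
    0 < jacobiIntegral ha hb (X ^ m * r i * r (i + m)) := by
  have hc : (X ^ m * r i).coeff (i + m) = (r i).leadingCoeff := by
    rw [coeff_X_pow_mul, leadingCoeff, hr.natDegree_eq]
  rw [apply_mul_of_natDegree_le hr.natDegree_eq hr.leadingCoeff_pos (hr.jacobiIntegral_mul ha hb),
    hc]
  · exact div_pos (hr.leadingCoeff_pos _) (hr.leadingCoeff_pos _)
  · refine natDegree_mul_le.trans ?_
    rw [natDegree_X_pow, hr.natDegree_eq, add_comm]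

/-- Coordinates of `X ^ m * r i` in the orthonormal basis. -/
theorem IsOrthonormalSystem.X_pow_mul_eq_sum
    (hr : IsOrthonormalSystem (jacobiMeasure a b) r) {m i N : ℕ} (h : i + m < N) :
    X ^ m * r i =
      ∑ k ∈ Finset.range N, C (jacobiIntegral ha hb (X ^ m * r i * r k)) * r k := by
  refine eq_sum_of_degree_lt hr.natDegree_eq hr.leadingCoeff_pos (hr.jacobiIntegral_mul ha hb)
    (degree_le_natDegree.trans_lt (Nat.cast_lt.2 (natDegree_mul_le.trans_lt ?_)))
  rw [natDegree_X_pow, hr.natDegree_eq]; omega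

theorem IsOrthonormalSystem.pencil_J₅_apply (hr : IsOrthonormalSystem (jacobiMeasure a b) r)
    (c d : ℝ) (i j : ℕ) : (pencil (jacobiMeasure a b) r c d).J₅ i j
      = jacobiIntegral ha hb (X ^ 2 * r i * r j) := by
  have h : X ^ 2 * r i * r j = ∑ k ∈ Finset.range (i + 2),
      jacobiIntegral ha hb (X ^ 1 * r i * r k) • (X ^ 1 * r k * r j) := by
    have := hr.X_pow_mul_eq_sum ha hb (show i + 1 < i + 2 by omega)
    rw [show X ^ 2 * r i * r j = X ^ 1 * r i * (X * r j) by ring]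
    nth_rw 1 [this]
    rw [Finset.sum_mul]
    refine Finset.sum_congr rfl fun k _ => ?_
    rw [smul_eq_C_mul]; ring
  rw [h, map_sum]
  simp only [map_smul, smul_eq_mul, pencil]
  rw [finsum_eq_sum_of_support_subset (s := Finset.range (i + 2))]
  · simp only [jacobiMatrix_apply ha hb]
  · intro k hk
    rw [Finset.coe_range, Set.mem_Iio]
    by_contra hlt
    refine hk ?_
    simp only [jacobiMatrix_apply ha hb]
    rw [hr.jacobiIntegral_X_pow_mul_eq_zero ha hb (show i + 1 < k by omega), zero_mul]

theorem IsOrthonormalSystem.isJacobiType_pencil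
    (hr : IsOrthonormalSystem (jacobiMeasure a b) r) :
    (pencil (jacobiMeasure a b) r 0 1).IsJacobiType where
  α_pos := by
    have := (hr.one_eq ha hb).1
    simp only [pencil, modelCoeff_zero_one, one_mul]
    positivity
  J₃_symm := Matrix.IsSymm.ext fun i j => by
    simp only [pencil, jacobiMatrix, mul_comm (eval _ (r i))]
  J₃_band i j h := by
    rw [pencil_J₃_apply ha hb, hr.jacobiIntegral_X_pow_mul_eq_zero ha hb h]
  J₃_pos n := by
    rw [pencil_J₃_apply ha hb, mul_assoc, mul_comm (r _), ← mul_assoc]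
    exact hr.jacobiIntegral_X_pow_mul_pos ha hb 1 n
  J₅_symm := Matrix.IsSymm.ext fun i j => by
    rw [hr.pencil_J₅_apply ha hb, hr.pencil_J₅_apply ha hb, mul_assoc, mul_comm (r _), ← mul_assoc]
  J₅_band i j h := by
    rw [hr.pencil_J₅_apply ha hb, hr.jacobiIntegral_X_pow_mul_eq_zero ha hb h]
  J₅_pos n := by
    rw [hr.pencil_J₅_apply ha hb, mul_assoc, mul_comm (r _), ← mul_assoc]
    exact hr.jacobiIntegral_X_pow_mul_pos ha hb 2 n

/-- The recurrence comes from `D (X² q) = X D (X q)`, where `D` is `divXTransform`, applied to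
`q = r n`: the rows of `J₃` and `J₅` are the coordinates of `X r n` and `X² r n`. -/
theorem IsOrthonormalSystem.isAssociated_pencil
    (hr : IsOrthonormalSystem (jacobiMeasure a b) r) :
    (pencil (jacobiMeasure a b) r 0 1).IsAssociated fun n => divXTransform (r n) where
  zero := by
    rw [hr.zero_eq ha hb, ← C_1]
    simp [divXTransform, -map_one]
  one := by
    refine mul_left_cancel₀ X_ne_zero ?_
    rw [X_mul_divXTransform, (hr.one_eq ha hb).2]
    simp only [pencil, modelCoeff_zero_one, modelCoeff_zero_zero]
    simp [neg_add_eq_sub, div_eq_mul_inv]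
    ring
  row n := by
    have h1 := hr.X_pow_mul_eq_sum ha hb (show n + 1 < n + 3 by omega)
    have h2 := hr.X_pow_mul_eq_sum ha hb (show n + 2 < n + 3 by omega)
    have h3 := congrArg divXTransform h1
    have h4 := congrArg divXTransform h2
    rw [divXTransform_sum, pow_one, divXTransform_X_mul] at h3
    rw [divXTransform_sum, pow_two, mul_assoc, divXTransform_X_mul] at h4
    rw [finsum_eq_sum_of_support_subset (s := Finset.range (n + 3))]
    · simp only [hr.pencil_J₅_apply ha hb, pencil_J₃_apply ha hb, sub_mul, Finset.sum_sub_distrib,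
        mul_assoc X, ← Finset.mul_sum]
      simp only [pow_one, pow_two, mul_assoc] at h3 h4 ⊢
      rw [← h3, ← h4]
      ring
    · intro k hk
      rw [Finset.coe_range, Set.mem_Iio]
      by_contra hlt
      have hΘ := hr.isJacobiType_pencil ha hb
      exact hk (by simp [hΘ.J₃_band n k (by omega), hΘ.J₅_band n k (by omega)])

theorem IsOrthonormalSystem.isSpectralFunction
    (hr : IsOrthonormalSystem (jacobiMeasure a b) r) :
    IsSpectralFunction (spectralForm (jacobiMeasure a b) 0 1) fun n => divXTransform (r n) := by
  have hint (u v : ℂ[X]) : Integrable (fun x : ℝ => u.eval (x : ℂ) *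
      starRingEnd ℂ (v.eval (x : ℂ))) (jacobiMeasure a b) :=
    integrable_jacobiMeasure ha hb (by fun_prop)
  refine ⟨⟨LinearMap.mk₂'ₛₗ (RingHom.id ℂ) (starRingEnd ℂ)
    (spectralForm (jacobiMeasure a b) 0 1) ?_ ?_ ?_ ?_, fun u v => rfl⟩, ?_⟩
  · intro u u' v
    simp only [spectralForm, map_add, LinearMap.add_apply, eval_add, add_mul]
    exact integral_add (hint _ _) (hint _ _)
  · intro c u v
    simp only [spectralForm, map_smul, LinearMap.smul_apply, eval_smul, smul_eq_mul,
      RingHom.id_apply, mul_assoc]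
    exact integral_const_mul _ _
  · intro u v v'
    simp only [spectralForm, map_add, LinearMap.add_apply, eval_add, mul_add]
    exact integral_add (hint _ _) (hint _ _)
  · intro c u v
    simp only [spectralForm, map_smul, LinearMap.smul_apply, eval_smul, smul_eq_mul, map_mul,
      mul_left_comm _ (starRingEnd ℂ c)]
    exact integral_const_mul _ _
  · intro n m
    have heval (q : ℝ[X]) (x : ℝ) : (q.map (algebraMap ℝ ℂ)).eval (x : ℂ) = (q.eval x : ℝ) := by
      simpa using eval_map_algebraMap q (x : ℂ) |>.trans (aeval_algebraMap_apply ℂ x q)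
    simp only [spectralForm, aeval_modelOp_divXTransform, heval, Complex.conj_ofReal,
      ← Complex.ofReal_mul]
    rw [integral_complex_ofReal, hr.orthonormal]
    split_ifs <;> simp

/-- By symmetry, `L (r n)` is orthogonal to all `r k` with `k < n`; its degree is at most `n`. -/
theorem IsOrthonormalSystem.jacobiOp_eq (hr : IsOrthonormalSystem (jacobiMeasure a b) r) (n : ℕ) :
    jacobiOp a b (r n) + C (n * (n + a + b + 1)) * r n = 0 := by
  have h := eq_sum_of_degree_lt hr.natDegree_eq hr.leadingCoeff_pos (hr.jacobiIntegral_mul ha hb)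
    (degree_le_natDegree.trans_lt (Nat.cast_lt.2 (Nat.lt_succ_of_le
      ((natDegree_jacobiOp_le a b (r n)).trans (hr.natDegree_eq n).le))))
  rw [Finset.sum_range_succ, Finset.sum_eq_zero, zero_add] at h
  · set μ := jacobiIntegral ha hb (jacobiOp a b (r n) * r n)
    have h0 : jacobiOp a b (r n) + C (-μ) * r n = 0 := by rw [h, C_neg]; ring
    have hne : r n ≠ 0 := leadingCoeff_ne_zero.1 (hr.leadingCoeff_pos n).ne'
    have he := eigenvalue_eq_of_jacobiOp hne h0
    rw [hr.natDegree_eq] at he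
    rwa [← he]
  · intro k hk
    rw [jacobiIntegral_jacobiOp_mul, mul_comm (r n), apply_mul_eq_zero hr.natDegree_eq
      hr.leadingCoeff_pos (hr.jacobiIntegral_mul ha hb), C_0, zero_mul]
    refine (natDegree_jacobiOp_le a b (r k)).trans_lt ?_
    rw [hr.natDegree_eq]
    exact Finset.mem_range.1 hk

end

end JacobiPencil

/-! ### Conclusion -/

theorem theorem4p2 (a b : ℝ) (ha : -1 < a) (hb : -1 < b)
    (r : ℕ → ℝ[X]) (hr : JacobiPencil.IsOrthonormalSystem (JacobiPencil.jacobiMeasure a b) r)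
    (p : ℕ → ℝ[X])
    (hp : (JacobiPencil.pencil (JacobiPencil.jacobiMeasure a b) r 0 1).IsAssociated p) :
    -- the constructed pencil is of Jacobi type and has the prescribed spectral function
    (JacobiPencil.pencil (JacobiPencil.jacobiMeasure a b) r 0 1).IsJacobiType ∧
    JacobiPencil.IsSpectralFunction
      (JacobiPencil.spectralForm (JacobiPencil.jacobiMeasure a b) 0 1) p ∧
    ∀ n : ℕ,
      -- `divX` removes the constant term and divides by the variable
      p n = r n - (r n - C ((r n).eval 0)).divX ∧
      -- `p n` is a solution of degree `n`
      (p n).degree = n ∧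
      JacobiPencil.IsSolution a b (n * (n + a + b + 1)) (p n) ∧
      -- uniqueness up to a constant multiple
      (∀ y : ℝ[X], y.degree = n → JacobiPencil.IsSolution a b (n * (n + a + b + 1)) y →
        ∃ k : ℝ, y = C k * p n) ∧
      -- uniqueness of the spectral parameter
      (∀ lam : ℝ, (∃ y : ℝ[X], y.degree = n ∧ JacobiPencil.IsSolution a b lam y) ↔
        lam = n * (n + a + b + 1)) := by
  have hΘ := hr.isJacobiType_pencil ha hb
  obtain rfl : p = fun n => JacobiPencil.divXTransform (r n) :=
    funext (hp.unique hΘ (hr.isAssociated_pencil ha hb))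
  refine ⟨hΘ, hr.isSpectralFunction ha hb, fun n => ?_⟩
  have hdeg : (r n).degree = n := by
    rw [degree_eq_natDegree (leadingCoeff_ne_zero.1 (hr.leadingCoeff_pos n).ne'), hr.natDegree_eq]
  have hode := hr.jacobiOp_eq ha hb n
  have hpdeg := (JacobiPencil.degree_divXTransform (r n)).trans hdeg
  have hsol := (JacobiPencil.isSolution_divXTransform_iff a b _ _).2 hode
  refine ⟨(JacobiPencil.divXTransform_sub_C _).symm, hpdeg, hsol, ?_, fun lam => ⟨?_, ?_⟩⟩
  · intro y hy hy'
    obtain ⟨q, rfl⟩ := JacobiPencil.divXTransform_surjective y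
    rw [JacobiPencil.degree_divXTransform] at hy
    rw [JacobiPencil.isSolution_divXTransform_iff] at hy'
    obtain ⟨k, rfl⟩ := JacobiPencil.eq_C_mul_of_jacobiOp ha hb hy hdeg hy' hode
    exact ⟨k, JacobiPencil.divXTransform_C_mul k _⟩
  · rintro ⟨y, hy, hy'⟩
    obtain ⟨q, rfl⟩ := JacobiPencil.divXTransform_surjective y
    rw [JacobiPencil.degree_divXTransform] at hy
    rw [JacobiPencil.isSolution_divXTransform_iff] at hy'
    have hq : q ≠ 0 := by rintro rfl; simp at hy
    rw [JacobiPencil.eigenvalue_eq_of_jacobiOp hq hy', natDegree_eq_of_degree_eq_some hy]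
  · rintro rfl
    exact ⟨_, hpdeg, hsol⟩
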